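/- Let $N\ge 1$ and let $\rho_1,\rho_2\in L^1(\mathbb{R}^N)\cap L^\infty(\mathbb{R}^N)$ be nonnegative, with $\rho_2$ not almost everywhere zero. For nonnegative integrable and essentially bounded functions $\sigma_1,\sigma_2$ on $\mathbb{R}^N$ and an integer $k\ge 0$ put $$\mu_k(\sigma_1,\sigma_2)=\inf_{S}\ \max_{u\in S\setminus\{0\}}\frac{\int_{\mathbb{R}^N}\sigma_1|\nabla u|^2\,dx}{\int_{\mathbb{R}^N}\sigma_2u^2\,dx}\in[0,+\infty],$$ where $S$ runs over the $(k+1)$-dimensional linear spaces of functions $u\in C_c^\infty(\mathbb{R}^N)$ for which the space $\{u\,1_{\{\sigma_2>0\}}:u\in S\}$, with functions identified when they agree almost everywhere, also has dimension $k+1$ (the infimum over the empty family is $+\infty$). For $\varepsilon>0$ let $B_{1/\varepsilon}$ be the ball of radius $1/\varepsilon$ centred at the origin and set $$\rho_1^\varepsilon(x)=\rho_1(x)+\varepsilon e^{-|x|^2/2},\qquad \rho_2^\varepsilon(x)=\rho_2(x)\,1_{B_{1/\varepsilon}}(x)+\varepsilon^2e^{-|x|^2/2}.$$ Then for every integer $k\ge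 0$, $$\mu_k(\rho_1^\varepsilon,\rho_2^\varepsilon)\longrightarrow\mu_k(\rho_1,\rho_2)\qquad\text{as }\varepsilon\to0^+ .$$ -/

import Mathlib

open MeasureTheory Filter Topology
open scoped ENNReal ContDiff

noncomputable section

namespace DensityEigenvalue

/-- The space `ℝ^N` with its Euclidean norm and Lebesgue measure. -/
abbrev Space (N : ℕ) : Type := EuclideanSpace ℝ (Fin N)

/-- The space `C_c^∞(ℝ^N)` of smooth, compactly supported real functions. -/
def testFunctions (N : ℕ) : Submodule ℝ (Space N → ℝ) where
  carrier := {u | ContDiff ℝ ∞ u ∧ HasCompactSupport u}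
  add_mem' := fun hu hv => ⟨hu.1.add hv.1, hu.2.add hv.2⟩
  zero_mem' := ⟨contDiff_const, HasCompactSupport.zero⟩
  smul_mem' := fun c _ hu => ⟨contDiff_const.smul hu.1, hu.2.smul_left (f := fun _ => c)⟩

/-- `AdmissibleSubspace ρ₂ k S`: `S` consists of test functions `u`, and the functions
`u · 1_{ρ₂ > 0}` with `u ∈ S`, taken up to equality almost everywhere, form a space of dimension
`k + 1`, parametrized by `S` (the map `u ↦ u · 1_{ρ₂ > 0}` has no kernel in `S`).
These are the subspaces of dimension `k + 1` in `{u · 1_{ρ₂ > 0} : u ∈ C_c^∞(ℝ^N)}`,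
each given together with the smooth functions `u` whose gradients enter the Rayleigh quotient. -/
structure AdmissibleSubspace {N : ℕ} (ρ₂ : Space N → ℝ) (k : ℕ)
    (S : Submodule ℝ (Space N → ℝ)) : Prop where
  le_testFunctions : S ≤ testFunctions N
  finrank_eq : Module.finrank ℝ S = k + 1
  eq_zero_of_restrict : ∀ u ∈ S, {x | 0 < ρ₂ x}.indicator u =ᵐ[volume] 0 → u = 0

/-- The Rayleigh quotient `∫ ρ₁ |∇u|² / ∫ ρ₂ u²`, with values in `[0, ∞]`. -/
def rayleigh {N : ℕ} (ρ₁ ρ₂ : Space N → ℝ) (u : Space N → ℝ) : ℝ≥0∞ :=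
  (∫⁻ x, ENNReal.ofReal (ρ₁ x * ‖gradient u x‖ ^ 2)) /
    (∫⁻ x, ENNReal.ofReal (ρ₂ x * u x ^ 2))

/-- The `k`-th eigenvalue `μ_k(ρ₁, ρ₂)` of the pair of densities, `k = 0, 1, 2, …`: the infimum
over the admissible subspaces `S` of the maximum of the Rayleigh quotient on `S \ {0}`.
For `ρ₂ = 0` no subspace is admissible and the value is `+∞`. -/
def eigenvalue {N : ℕ} (k : ℕ) (ρ₁ ρ₂ : Space N → ℝ) : ℝ≥0∞ :=
  ⨅ (S : Submodule ℝ (Space N → ℝ)) (_ : AdmissibleSubspace ρ₂ k S),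
    ⨆ (u : Space N → ℝ) (_ : u ∈ S ∧ u ≠ 0), rayleigh ρ₁ ρ₂ u

/-- `ρ₁^ε = ρ₁ + ε e^{-|x|²/2}`. -/
def regNum {N : ℕ} (ρ₁ : Space N → ℝ) (ε : ℝ) : Space N → ℝ :=
  fun x => ρ₁ x + ε * Real.exp (-‖x‖ ^ 2 / 2)

/-- `ρ₂^ε = ρ₂ 1_{B_{1/ε}} + ε² e^{-|x|²/2}`. -/
def regDen {N : ℕ} (ρ₂ : Space N → ℝ) (ε : ℝ) : Space N → ℝ :=
  fun x => (Metric.ball (0 : Space N) (1 / ε)).indicator ρ₂ x + ε ^ 2 * Real.exp (-‖x‖ ^ 2 / 2)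

end DensityEigenvalue

end

/-!
The upper bound for the limit is soft. A space `S` admissible for `ρ₂` is admissible for `ρ₂^ε` once
`B_{1/ε}` contains the supports of its functions, and on the finite-dimensional space `S` the Gaussian
energy `∫ |∇u|² γ`, with `γ(x) = e^{-|x|²/2}`, is at most `C ∫ ρ₂ u²`, so that the quotients grow by at
most `C ε` (`eventually_eigenvalue_reg_le`).

For the lower bound no compactness or passage to limits of eigenfunctions is needed: a space `S` on
which the regularized quotients are at most `a` is itself a competitor for `(ρ₁, ρ₂)`. The point is
that the Gaussian part `ε² ∫ u² γ` of the regularized denominator is negligible. The Gaussian Poincaré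
inequality, combined with the positivity of `ρ₂` on a set of positive measure, gives
`∫ u² γ ≤ A ∫ |∇u|² γ + B ∫ ρ₂ u²` (`exists_lintegral_gaussianWeight_sq_enorm_le`). Since the numerator
contains `ε ∫ |∇u|² γ`, which is therefore at most `a` times the regularized denominator `T`, the
Gaussian part is at most `ε A a T + ε² B ∫ ρ₂ u²`. Absorbing the first term yields
`T ≤ (1 + O(ε)) ∫ ρ₂ u²` (`lintegral_regDen_le`), which shows both that `S` is admissible for `ρ₂` and
that its quotients for `(ρ₁, ρ₂)` are at most `(1 + O(ε)) a` (`eigenvalue_le_of_eigenvalue_reg_lt`).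

The Poincaré inequality is proved in the form `∬ |u(y) - u(x)|² γ γ ≤ K ∫ |∇u|² γ`, by integrating the
derivative of `u` along the arcs `θ ↦ cos θ x + sin θ y` and using the invariance of the product of two
Gaussian measures under rotations; the value of `K` plays no role.

Integrals against densities are written as integrals against the measures `densityMeasure ρ`, in
which the two regularizations are sums of measures.
-/

namespace DensityEigenvalue

/-! ### A Poincaré inequality for the Gaussian weight -/

section Gaussian

open ProbabilityTheory

/-- The Cauchy–Schwarz inequality against the constant function `1`. -/
lemma sq_lintegral_le_measure_univ_mul {α : Type*} [MeasurableSpace α] (ν : Measure α)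
    {f : α → ℝ≥0∞} (hf : AEMeasurable f ν) :
    (∫⁻ x, f x ∂ν) ^ 2 ≤ ν Set.univ * ∫⁻ x, f x ^ 2 ∂ν := by
  have h := ENNReal.lintegral_mul_le_Lp_mul_Lq ν Real.HolderConjugate.two_two
    (aemeasurable_const (b := (1 : ℝ≥0∞))) hf
  simp only [Pi.mul_apply, one_mul, ENNReal.rpow_two, one_pow, lintegral_one] at h
  calc (∫⁻ x, f x ∂ν) ^ 2
      ≤ (ν Set.univ ^ (1 / 2 : ℝ) * (∫⁻ x, f x ^ 2 ∂ν) ^ (1 / 2 : ℝ)) ^ 2 := by gcongr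
    _ = ν Set.univ * ∫⁻ x, f x ^ 2 ∂ν := by
      rw [mul_pow, ← ENNReal.rpow_two, ← ENNReal.rpow_two, ← ENNReal.rpow_mul,
        ← ENNReal.rpow_mul]
      norm_num

/-- Two points `p.1`, `p.2` are joined by the arc `θ ↦ (R_θ p).1`, `0 ≤ θ ≤ π / 2`, whose velocity
is `(R_θ p).2`. -/
lemma sq_enorm_sub_le_lintegral_rotation {E : Type*} [NormedAddCommGroup E] [NormedSpace ℝ E]
    {u : E → ℝ} (hu : ContDiff ℝ 1 u) (p : E × E) :
    ‖u p.2 - u p.1‖ₑ ^ 2 ≤ ENNReal.ofReal (Real.pi / 2) *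
      ∫⁻ θ in Set.Ioc 0 (Real.pi / 2),
        ‖fderiv ℝ u (ContinuousLinearMap.rotation θ p).1‖ₑ ^ 2 *
          ‖(ContinuousLinearMap.rotation θ p).2‖ₑ ^ 2 := by
  have hd : Continuous (fderiv ℝ u) := hu.continuous_fderiv one_ne_zero
  simp only [ContinuousLinearMap.rotation_apply]
  set a : ℝ → E := fun θ => Real.cos θ • p.1 + Real.sin θ • p.2 with ha
  set b : ℝ → E := fun θ => -Real.sin θ • p.1 + Real.cos θ • p.2 with hb
  have hac : Continuous a := by fun_prop
  have hbc : Continuous b := by fun_prop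
  have hderiv : ∀ θ : ℝ, HasDerivAt (fun θ => u (a θ)) (fderiv ℝ u (a θ) (b θ)) θ := by
    intro θ
    have h1 : HasDerivAt a (b θ) θ :=
      ((Real.hasDerivAt_cos θ).smul_const p.1).add ((Real.hasDerivAt_sin θ).smul_const p.2)
    exact ((hu.differentiable one_ne_zero (a θ)).hasFDerivAt).comp_hasDerivAt θ h1
  have hcont : Continuous fun θ => fderiv ℝ u (a θ) (b θ) := (hd.comp hac).clm_apply hbc
  have hint := intervalIntegral.integral_eq_sub_of_hasDerivAt (a := 0) (b := Real.pi / 2)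
    (fun θ _ => hderiv θ) (hcont.intervalIntegrable _ _)
  have h0 : u p.2 - u p.1 = ∫ θ in Set.Ioc 0 (Real.pi / 2), fderiv ℝ u (a θ) (b θ) := by
    rw [← intervalIntegral.integral_of_le (by positivity), hint]
    simp [ha]
  calc ‖u p.2 - u p.1‖ₑ ^ 2
      ≤ (∫⁻ θ in Set.Ioc 0 (Real.pi / 2), ‖fderiv ℝ u (a θ)‖ₑ * ‖b θ‖ₑ) ^ 2 := by
        rw [h0]
        gcongr
        refine (enorm_integral_le_lintegral_enorm _).trans (lintegral_mono fun θ => ?_)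
        exact ContinuousLinearMap.le_opENorm _ _
    _ ≤ _ := by
        refine (sq_lintegral_le_measure_univ_mul _ ?_).trans_eq ?_
        · exact (((hd.comp hac).enorm.measurable).mul hbc.enorm.measurable).aemeasurable
        · simp only [mul_pow, Measure.restrict_apply_univ, Real.volume_Ioc, sub_zero]
          rfl

variable {E : Type*} [NormedAddCommGroup E] [InnerProductSpace ℝ E] [FiniteDimensional ℝ E]
  [MeasurableSpace E] [BorelSpace E]

/-- The average over two independent Gaussian points of the squared difference of `u` is bounded
by the Gaussian Dirichlet energy: integrating along rotations, `(X, Y)` may be replaced by the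
rotated pair, which has the same law. -/
lemma lintegral_prod_stdGaussian_sq_enorm_sub_le {u : E → ℝ} (hu : ContDiff ℝ 1 u) :
    ∫⁻ p : E × E, ‖u p.2 - u p.1‖ₑ ^ 2 ∂(stdGaussian E).prod (stdGaussian E) ≤
      ENNReal.ofReal (Real.pi / 2) ^ 2 * (∫⁻ y, ‖y‖ₑ ^ 2 ∂stdGaussian E) *
        ∫⁻ x, ‖fderiv ℝ u x‖ₑ ^ 2 ∂stdGaussian E := by
  have hd : Continuous (fderiv ℝ u) := hu.continuous_fderiv one_ne_zero
  set F : E × E → ℝ≥0∞ := fun q => ‖fderiv ℝ u q.1‖ₑ ^ 2 * ‖q.2‖ₑ ^ 2 with hF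
  have hFm : Measurable F :=
    ((hd.comp continuous_fst).enorm.measurable.pow_const 2).mul
      (continuous_snd.enorm.measurable.pow_const 2)
  have hrot : Continuous fun q : (E × E) × ℝ => ContinuousLinearMap.rotation q.2 q.1 := by
    simp only [ContinuousLinearMap.rotation_apply]
    fun_prop
  have hinv : ∀ θ : ℝ, ∫⁻ p, F (ContinuousLinearMap.rotation θ p)
      ∂(stdGaussian E).prod (stdGaussian E) =
        (∫⁻ x, ‖fderiv ℝ u x‖ₑ ^ 2 ∂stdGaussian E) * ∫⁻ y, ‖y‖ₑ ^ 2 ∂stdGaussian E := by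
    intro θ
    rw [← lintegral_map hFm (ContinuousLinearMap.rotation θ).continuous.measurable,
      IsGaussian.map_rotation_eq_self integral_id_stdGaussian, hF,
      lintegral_prod_mul (hd.enorm.measurable.pow_const 2).aemeasurable
        (continuous_enorm.measurable.pow_const 2).aemeasurable]
  calc ∫⁻ p : E × E, ‖u p.2 - u p.1‖ₑ ^ 2 ∂(stdGaussian E).prod (stdGaussian E)
      ≤ ∫⁻ p : E × E, ENNReal.ofReal (Real.pi / 2) * (∫⁻ θ in Set.Ioc 0 (Real.pi / 2),
          F (ContinuousLinearMap.rotation θ p)) ∂(stdGaussian E).prod (stdGaussian E) :=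
        lintegral_mono fun p => sq_enorm_sub_le_lintegral_rotation hu p
    _ = ENNReal.ofReal (Real.pi / 2) * ∫⁻ θ in Set.Ioc 0 (Real.pi / 2),
          ∫⁻ p : E × E, F (ContinuousLinearMap.rotation θ p)
            ∂(stdGaussian E).prod (stdGaussian E) := by
        rw [lintegral_const_mul' _ _ ENNReal.ofReal_ne_top, lintegral_lintegral_swap]
        exact (hFm.comp hrot.measurable).aemeasurable
    _ = _ := by
        simp only [hinv, lintegral_const, Measure.restrict_apply_univ, Real.volume_Ioc, sub_zero]
        ring

variable (E) in
/-- The measure `e^{-|x|²/2} dx`, without the normalizing constant. -/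
noncomputable def gaussianWeight : Measure E :=
  volume.withDensity fun x => ENNReal.ofReal (Real.exp (-‖x‖ ^ 2 / 2))

lemma integrable_gaussian_density : Integrable (fun x : E => Real.exp (-‖x‖ ^ 2 / 2)) := by
  have h := (GaussianFourier.integrable_cexp_neg_mul_sq_norm_add (V := E) (b := 1 / 2)
    (by norm_num) 0 0).re
  refine h.congr (Eventually.of_forall fun x => ?_)
  simp only [zero_mul, add_zero]
  rw [← Complex.ofReal_re (Real.exp _), RCLike.re_eq_complex_re]
  push_cast
  congr 2
  ring

instance : IsFiniteMeasure (gaussianWeight E) :=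
  isFiniteMeasure_withDensity_ofReal integrable_gaussian_density.2

variable (E) in
/-- The two finite measures have proportional characteristic functions. -/
lemma exists_gaussianWeight_eq_smul_stdGaussian :
    ∃ c : NNReal, gaussianWeight E = c • stdGaussian E := by
  set c : ℝ := (2 * Real.pi) ^ (Module.finrank ℝ E / 2 : ℝ) with hc
  refine ⟨c.toNNReal, Measure.ext_of_charFun (funext fun t => ?_)⟩
  have h1 : charFun (c.toNNReal • stdGaussian E) t = c * Complex.exp (-‖t‖ ^ 2 / 2) := by
    rw [charFun_apply, integral_smul_nnreal_measure, ← charFun_apply, charFun_stdGaussian,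
      NNReal.smul_def, Real.coe_toNNReal _ (by positivity)]
    simp
  have h2 := GaussianFourier.integral_cexp_neg_mul_sq_norm_add (V := E) (b := 1 / 2)
    (by norm_num) Complex.I t
  rw [h1, charFun_apply, gaussianWeight, integral_withDensity_eq_integral_toReal_smul
    (by fun_prop) (by simp)]
  calc _ = ∫ v : E, Complex.exp (-(1 / 2) * ‖v‖ ^ 2 + Complex.I * inner ℝ t v) := by
        congr 1 with v
        rw [ENNReal.toReal_ofReal (Real.exp_pos _).le, Complex.exp_add, Complex.real_smul,
          real_inner_comm, mul_comm Complex.I]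
        push_cast
        congr 2
        ring
    _ = _ := by
        rw [h2, hc, Complex.ofReal_cpow (by positivity)]
        push_cast
        congr 2
        · ring
        · rw [Complex.I_sq]; ring

variable (E) in
/-- The Poincaré inequality for the Gaussian weight, in the form that compares the values of `u`
at two independent points. -/
theorem exists_lintegral_gaussianWeight_sq_enorm_sub_le :
    ∃ K : NNReal, ∀ u : E → ℝ, ContDiff ℝ 1 u →
      ∫⁻ x, ∫⁻ y, ‖u y - u x‖ₑ ^ 2 ∂gaussianWeight E ∂gaussianWeight E ≤
        K * ∫⁻ x, ‖fderiv ℝ u x‖ₑ ^ 2 ∂gaussianWeight E := by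
  obtain ⟨c, hc⟩ := exists_gaussianWeight_eq_smul_stdGaussian E
  have hfin : ∫⁻ y, ‖y‖ₑ ^ 2 ∂stdGaussian E < ⊤ := by
    have h := (IsGaussian.memLp_two_id (μ := stdGaussian E)).eLpNorm_lt_top
    have h' := eLpNorm_nnreal_pow_eq_lintegral (μ := stdGaussian E) (f := id (α := E)) (p := 2)
      (by norm_num)
    simp only [NNReal.coe_ofNat, ENNReal.rpow_two, ENNReal.coe_ofNat, id] at h'
    rw [← h']
    exact ENNReal.pow_lt_top h
  obtain ⟨M, hM⟩ := ENNReal.canLift.prf _ hfin.ne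
  refine ⟨c * ((Real.pi / 2).toNNReal ^ 2 * M), fun u hu => ?_⟩
  have hm : Measurable fun p : E × E => ‖u p.2 - u p.1‖ₑ ^ 2 := by
    have := hu.continuous
    exact Continuous.measurable (by fun_prop)
  have h := lintegral_prod_stdGaussian_sq_enorm_sub_le hu
  rw [lintegral_prod _ hm.aemeasurable, ← hM] at h
  rw [hc]
  simp only [lintegral_smul_measure, ENNReal.smul_def, smul_eq_mul]
  rw [lintegral_const_mul' _ _ ENNReal.coe_ne_top]
  calc _ ≤ (c : ℝ≥0∞) * (c * (ENNReal.ofReal (Real.pi / 2) ^ 2 * M *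
        ∫⁻ x, ‖fderiv ℝ u x‖ₑ ^ 2 ∂stdGaussian E)) := by gcongr
    _ = _ := by
      rw [ENNReal.ofReal]
      push_cast
      ring

end Gaussian

/-! ### Control of the Gaussian mass by the Gaussian energy and a weighted mass -/

lemma lintegral_sq_enorm_mul_le_of_measure_le {α : Type*} [MeasurableSpace α] {ν γ : Measure α}
    (hνγ : ν ≤ γ) {f : α → ℝ} (hf : Measurable f) :
    ν Set.univ * ∫⁻ x, ‖f x‖ₑ ^ 2 ∂γ ≤
      2 * (∫⁻ x, ∫⁻ y, ‖f y - f x‖ₑ ^ 2 ∂γ ∂γ) + 2 * γ Set.univ * ∫⁻ x, ‖f x‖ₑ ^ 2 ∂ν := by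
  have hsq : ∀ r : ℝ, ‖r‖ₑ ^ 2 = ENNReal.ofReal (r ^ 2) := fun r => by
    rw [Real.enorm_eq_ofReal_abs, ← ENNReal.ofReal_pow (abs_nonneg r), sq_abs]
  have hpt : ∀ x y, ‖f x‖ₑ ^ 2 ≤ 2 * ‖f y - f x‖ₑ ^ 2 + 2 * ‖f y‖ₑ ^ 2 := by
    intro x y
    rw [← mul_add, hsq, hsq, hsq, ← ENNReal.ofReal_add (by positivity) (by positivity),
      ← ENNReal.ofReal_ofNat 2, ← ENNReal.ofReal_mul (by norm_num)]
    exact ENNReal.ofReal_le_ofReal (by nlinarith [sq_nonneg (f x - 2 * f y)])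
  have hm : Measurable fun y => ‖f y‖ₑ ^ 2 := hf.enorm.pow_const 2
  have hinner : ∀ x, ν Set.univ * ‖f x‖ₑ ^ 2 ≤
      2 * (∫⁻ y, ‖f y - f x‖ₑ ^ 2 ∂γ) + 2 * ∫⁻ y, ‖f y‖ₑ ^ 2 ∂ν := by
    intro x
    calc ν Set.univ * ‖f x‖ₑ ^ 2 = ∫⁻ _, ‖f x‖ₑ ^ 2 ∂ν := by rw [lintegral_const, mul_comm]
      _ ≤ ∫⁻ y, (2 * ‖f y - f x‖ₑ ^ 2 + 2 * ‖f y‖ₑ ^ 2) ∂ν := lintegral_mono fun y => hpt x y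
      _ = 2 * (∫⁻ y, ‖f y - f x‖ₑ ^ 2 ∂ν) + 2 * ∫⁻ y, ‖f y‖ₑ ^ 2 ∂ν := by
        rw [lintegral_add_right _ (hm.const_mul 2), lintegral_const_mul' _ _ (by simp),
          lintegral_const_mul' _ _ (by simp)]
      _ ≤ _ := by gcongr
  calc ν Set.univ * ∫⁻ x, ‖f x‖ₑ ^ 2 ∂γ = ∫⁻ x, ν Set.univ * ‖f x‖ₑ ^ 2 ∂γ :=
        (lintegral_const_mul _ hm).symm
    _ ≤ ∫⁻ x, (2 * (∫⁻ y, ‖f y - f x‖ₑ ^ 2 ∂γ) + 2 * ∫⁻ y, ‖f y‖ₑ ^ 2 ∂ν) ∂γ :=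
        lintegral_mono hinner
    _ = _ := by
        rw [lintegral_add_right _ measurable_const, lintegral_const_mul' _ _ (by simp),
          lintegral_const]
        ring

/-- The measure `ρ dx` of a real density `ρ`; negative values of `ρ` are replaced by `0`. -/
noncomputable def densityMeasure {N : ℕ} (ρ : Space N → ℝ) : Measure (Space N) :=
  volume.withDensity fun x => ENNReal.ofReal (ρ x)

/-- The Gaussian mass of `u` is controlled by its Gaussian energy and its mass for a density `ρ` that
is positive on a set of positive measure: the energy bounds the oscillation of `u`, and the second
term excludes large constants. The measure with density `min ρ e^{-|x|²/2}` transfers the two-point form of the Poincaré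
inequality from the Gaussian weight to `ρ`. -/
theorem exists_lintegral_gaussianWeight_sq_enorm_le {N : ℕ} {ρ : Space N → ℝ}
    (hρ : AEMeasurable ρ) (hρ_pos : ¬ ρ ≤ᵐ[volume] 0) :
    ∃ A B : NNReal, ∀ u : Space N → ℝ, ContDiff ℝ 1 u →
      ∫⁻ x, ‖u x‖ₑ ^ 2 ∂gaussianWeight (Space N) ≤
        A * (∫⁻ x, ‖fderiv ℝ u x‖ₑ ^ 2 ∂gaussianWeight (Space N)) +
          B * ∫⁻ x, ‖u x‖ₑ ^ 2 ∂densityMeasure ρ := by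
  obtain ⟨K, hK⟩ := exists_lintegral_gaussianWeight_sq_enorm_sub_le (Space N)
  set g : Space N → ℝ≥0∞ := fun x => ENNReal.ofReal (Real.exp (-‖x‖ ^ 2 / 2)) with hg
  have hgm : Measurable g := by fun_prop
  -- The minimum lies below both densities, and it is still positive on a set of positive measure.
  set ν : Measure (Space N) := volume.withDensity fun x => min (ENNReal.ofReal (ρ x)) (g x)
    with hν
  have hν₁ : ν ≤ densityMeasure ρ := withDensity_mono (ae_of_all _ fun x => min_le_left _ _)
  have hν₂ : ν ≤ gaussianWeight (Space N) :=
    withDensity_mono (ae_of_all _ fun x => min_le_right _ _)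
  have hν0 : ν Set.univ ≠ 0 := by
    rw [hν, withDensity_apply _ MeasurableSet.univ, Measure.restrict_univ]
    intro h0
    rw [lintegral_eq_zero_iff' (hρ.ennreal_ofReal.min hgm.aemeasurable)] at h0
    refine hρ_pos (h0.mono fun x hx => ?_)
    have hgx : 0 < g x := ENNReal.ofReal_pos.2 (Real.exp_pos _)
    have : ENNReal.ofReal (ρ x) = 0 := by
      rcases min_choice (ENNReal.ofReal (ρ x)) (g x) with h | h
      · exact h ▸ hx
      · exact absurd (h ▸ hx) hgx.ne'
    simpa using this
  have hνtop : ν Set.univ ≠ ⊤ := ((hν₂ Set.univ).trans_lt (measure_lt_top _ _)).ne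
  set c : NNReal := (ν Set.univ).toNNReal
  have hc : (c : ℝ≥0∞) = ν Set.univ := ENNReal.coe_toNNReal hνtop
  set G : NNReal := (gaussianWeight (Space N) Set.univ).toNNReal
  have hG : (G : ℝ≥0∞) = gaussianWeight (Space N) Set.univ :=
    ENNReal.coe_toNNReal (measure_ne_top _ _)
  have hc0 : c ≠ 0 := fun h => hν0 (by rw [← hc, h]; rfl)
  refine ⟨c⁻¹ * (2 * K), c⁻¹ * (2 * G), fun u hu => ?_⟩
  have h := lintegral_sq_enorm_mul_le_of_measure_le hν₂ hu.continuous.measurable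
  rw [← hc, ← hG] at h
  have h' : (c : ℝ≥0∞) * ∫⁻ x, ‖u x‖ₑ ^ 2 ∂gaussianWeight (Space N) ≤
      2 * (K * ∫⁻ x, ‖fderiv ℝ u x‖ₑ ^ 2 ∂gaussianWeight (Space N)) +
        2 * G * ∫⁻ x, ‖u x‖ₑ ^ 2 ∂densityMeasure ρ :=
    h.trans (by gcongr; exact hK u hu)
  calc ∫⁻ x, ‖u x‖ₑ ^ 2 ∂gaussianWeight (Space N)
      = (c : ℝ≥0∞)⁻¹ * (c * ∫⁻ x, ‖u x‖ₑ ^ 2 ∂gaussianWeight (Space N)) := by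
        rw [← mul_assoc, ENNReal.inv_mul_cancel (by simpa using hc0) ENNReal.coe_ne_top, one_mul]
    _ ≤ (c : ℝ≥0∞)⁻¹ * (2 * (K * ∫⁻ x, ‖fderiv ℝ u x‖ₑ ^ 2 ∂gaussianWeight (Space N)) +
        2 * G * ∫⁻ x, ‖u x‖ₑ ^ 2 ∂densityMeasure ρ) := by gcongr
    _ = _ := by
        push_cast [ENNReal.coe_inv hc0]
        ring

/-! ### The densities as measures -/

variable {N : ℕ}

lemma rayleigh_eq_densityMeasure {ρ₁ ρ₂ : Space N → ℝ} (h₁ : AEMeasurable ρ₁)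
    (h₂ : AEMeasurable ρ₂) {u : Space N → ℝ} (hu : ContDiff ℝ 1 u) :
    rayleigh ρ₁ ρ₂ u = (∫⁻ x, ‖fderiv ℝ u x‖ₑ ^ 2 ∂densityMeasure ρ₁) /
      ∫⁻ x, ‖u x‖ₑ ^ 2 ∂densityMeasure ρ₂ := by
  have hd : Continuous (fderiv ℝ u) := hu.continuous_fderiv one_ne_zero
  rw [rayleigh, densityMeasure, densityMeasure,
    lintegral_withDensity_eq_lintegral_mul₀ h₁.ennreal_ofReal
      (hd.enorm.measurable.pow_const 2).aemeasurable,
    lintegral_withDensity_eq_lintegral_mul₀ h₂.ennreal_ofReal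
      (hu.continuous.enorm.measurable.pow_const 2).aemeasurable]
  congr 2 with x
  · rw [Pi.mul_apply, ENNReal.ofReal_mul' (by positivity), ENNReal.ofReal_pow (norm_nonneg _),
      ofReal_norm, gradient, LinearIsometryEquiv.enorm_map]
  · rw [Pi.mul_apply, ENNReal.ofReal_mul' (by positivity), ← sq_abs,
      ENNReal.ofReal_pow (abs_nonneg _), Real.enorm_eq_ofReal_abs]

lemma lintegral_densityMeasure_eq_zero_iff {ρ : Space N → ℝ} (hρ : AEMeasurable ρ)
    {u : Space N → ℝ} (hu : Continuous u) :
    ∫⁻ x, ‖u x‖ₑ ^ 2 ∂densityMeasure ρ = 0 ↔ {x | 0 < ρ x}.indicator u =ᵐ[volume] 0 := by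
  rw [lintegral_eq_zero_iff (hu.enorm.measurable.pow_const 2)]
  unfold EventuallyEq
  rw [densityMeasure, ae_withDensity_iff' hρ.ennreal_ofReal]
  refine eventually_congr (Eventually.of_forall fun x => ?_)
  by_cases hx : 0 < ρ x <;> simp [hx]

lemma densityMeasure_regNum {ρ : Space N → ℝ} (hρ0 : 0 ≤ᵐ[volume] ρ) {ε : ℝ} (hε : 0 ≤ ε) :
    densityMeasure (regNum ρ ε) =
      densityMeasure ρ + ENNReal.ofReal ε • gaussianWeight (Space N) := by
  rw [densityMeasure, densityMeasure, gaussianWeight, ← withDensity_smul _ (by fun_prop),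
    ← withDensity_add_right _ (by fun_prop)]
  refine withDensity_congr_ae (hρ0.mono fun x hx => ?_)
  simp only [regNum, Pi.add_apply, Pi.smul_apply, smul_eq_mul]
  rw [ENNReal.ofReal_add hx (by positivity), ENNReal.ofReal_mul hε]

lemma densityMeasure_regDen {ρ : Space N → ℝ} (hρ0 : 0 ≤ᵐ[volume] ρ) {ε : ℝ} (hε : 0 ≤ ε) :
    densityMeasure (regDen ρ ε) = (densityMeasure ρ).restrict (Metric.ball 0 (1 / ε)) +
      ENNReal.ofReal ε ^ 2 • gaussianWeight (Space N) := by
  rw [densityMeasure, densityMeasure, gaussianWeight, ← withDensity_smul _ (by fun_prop),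
    restrict_withDensity Metric.isOpen_ball.measurableSet,
    ← withDensity_indicator Metric.isOpen_ball.measurableSet,
    ← withDensity_add_right _ (by fun_prop)]
  refine withDensity_congr_ae (hρ0.mono fun x hx => ?_)
  have hind : 0 ≤ (Metric.ball (0 : Space N) (1 / ε)).indicator ρ x :=
    Set.indicator_apply_nonneg fun _ => hx
  simp only [regDen, Pi.add_apply, Pi.smul_apply, smul_eq_mul]
  rw [ENNReal.ofReal_add hind (by positivity), ENNReal.ofReal_mul (by positivity),
    ENNReal.ofReal_pow hε]
  congr 1
  by_cases hxb : x ∈ Metric.ball (0 : Space N) (1 / ε)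
  · rw [Set.indicator_of_mem hxb, Set.indicator_of_mem hxb]
  · rw [Set.indicator_of_notMem hxb, Set.indicator_of_notMem hxb, ENNReal.ofReal_zero]

lemma aemeasurable_regNum {ρ : Space N → ℝ} (hρ : AEMeasurable ρ) (ε : ℝ) :
    AEMeasurable (regNum ρ ε) :=
  hρ.add (by fun_prop)

lemma aemeasurable_regDen {ρ : Space N → ℝ} (hρ : AEMeasurable ρ) (ε : ℝ) :
    AEMeasurable (regDen ρ ε) :=
  (hρ.indicator Metric.isOpen_ball.measurableSet).add (by fun_prop)

lemma admissibleSubspace_iff {ρ : Space N → ℝ} (hρ : AEMeasurable ρ) {k : ℕ}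
    {S : Submodule ℝ (Space N → ℝ)} :
    AdmissibleSubspace ρ k S ↔ S ≤ testFunctions N ∧ Module.finrank ℝ S = k + 1 ∧
      ∀ u ∈ S, ∫⁻ x, ‖u x‖ₑ ^ 2 ∂densityMeasure ρ = 0 → u = 0 := by
  constructor
  · intro h
    exact ⟨h.1, h.2, fun u hu h0 => h.3 u hu
      ((lintegral_densityMeasure_eq_zero_iff hρ (h.1 hu).1.continuous).1 h0)⟩
  · intro h
    exact ⟨h.1, h.2.1, fun u hu h0 => h.2.2 u hu
      ((lintegral_densityMeasure_eq_zero_iff hρ (h.1 hu).1.continuous).2 h0)⟩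

lemma eq_zero_of_lintegral_gaussianWeight_eq_zero {u : Space N → ℝ} (hu : Continuous u)
    (h : ∫⁻ x, ‖u x‖ₑ ^ 2 ∂gaussianWeight (Space N) = 0) : u = 0 := by
  have h' := (lintegral_densityMeasure_eq_zero_iff
    (ρ := fun x : Space N => Real.exp (-‖x‖ ^ 2 / 2)) (by fun_prop) hu).1 h
  simp only [Real.exp_pos, Set.ofPred_true, Set.indicator_univ] at h'
  exact Continuous.ae_eq_iff_eq volume hu continuous_const |>.1 h'

/-! ### The upper bound: finite-dimensional spaces of test functions -/

/-- On a finite-dimensional space, a linear map is bounded by any injective one. -/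
lemma exists_enorm_le_of_injective {V F₁ F₂ : Type*} [AddCommGroup V] [Module ℝ V]
    [FiniteDimensional ℝ V] [NormedAddCommGroup F₁] [NormedSpace ℝ F₁] [NormedAddCommGroup F₂]
    [NormedSpace ℝ F₂] (T : V →ₗ[ℝ] F₁) (hT : Function.Injective T) (L : V →ₗ[ℝ] F₂) :
    ∃ C : NNReal, ∀ v, ‖L v‖ₑ ≤ C * ‖T v‖ₑ := by
  set M : LinearMap.range T →L[ℝ] F₂ :=
    (L ∘ₗ (LinearEquiv.ofInjective T hT).symm.toLinearMap).toContinuousLinearMap with hM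
  refine ⟨‖M‖₊, fun v => ?_⟩
  have h : M (LinearEquiv.ofInjective T hT v) = L v := by simp [hM]
  rw [← h]
  exact ContinuousLinearMap.le_opENorm M _

/-- The linear map into `L²` induced by a linear map `Φ` into functions whose values `Φ v` are all
square-integrable. -/
noncomputable def toLpTwo {α V F : Type*} [MeasurableSpace α] [AddCommGroup V] [Module ℝ V]
    [NormedAddCommGroup F] [NormedSpace ℝ F] (μ : Measure α) (Φ : V →ₗ[ℝ] α → F)
    (h : ∀ v, MemLp (Φ v) 2 μ) : V →ₗ[ℝ] Lp F 2 μ where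
  toFun v := (h v).toLp
  map_add' v w := by
    rw [← MemLp.toLp_add (h v) (h w)]
    exact MemLp.toLp_congr _ _ (by rw [map_add])
  map_smul' c v := by
    rw [RingHom.id_apply, ← MemLp.toLp_const_smul c (h v)]
    exact MemLp.toLp_congr _ _ (by rw [map_smul])

lemma enorm_toLpTwo_sq {α V F : Type*} [MeasurableSpace α] [AddCommGroup V] [Module ℝ V]
    [NormedAddCommGroup F] [NormedSpace ℝ F] (μ : Measure α) (Φ : V →ₗ[ℝ] α → F)
    (h : ∀ v, MemLp (Φ v) 2 μ) (v : V) :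
    ‖toLpTwo μ Φ h v‖ₑ ^ 2 = ∫⁻ x, ‖Φ v x‖ₑ ^ 2 ∂μ := by
  have h' := eLpNorm_nnreal_pow_eq_lintegral (μ := μ) (f := Φ v) (p := 2) (by norm_num)
  simp only [NNReal.coe_ofNat, ENNReal.rpow_two, ENNReal.coe_ofNat] at h'
  rw [← h', toLpTwo]
  exact congrArg (· ^ 2) (Lp.enorm_toLp (hf := h v))

lemma exists_lintegral_sq_enorm_le {α β V F G : Type*} [MeasurableSpace α] [MeasurableSpace β]
    [AddCommGroup V] [Module ℝ V] [FiniteDimensional ℝ V] [NormedAddCommGroup F]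
    [NormedSpace ℝ F] [NormedAddCommGroup G] [NormedSpace ℝ G] {μ : Measure α} {ν : Measure β}
    (Φ : V →ₗ[ℝ] α → F) (hΦ : ∀ v, MemLp (Φ v) 2 μ)
    (hΦ0 : ∀ v, ∫⁻ x, ‖Φ v x‖ₑ ^ 2 ∂μ = 0 → v = 0)
    (Ψ : V →ₗ[ℝ] β → G) (hΨ : ∀ v, MemLp (Ψ v) 2 ν) :
    ∃ C : NNReal, ∀ v, ∫⁻ x, ‖Ψ v x‖ₑ ^ 2 ∂ν ≤ C * ∫⁻ x, ‖Φ v x‖ₑ ^ 2 ∂μ := by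
  obtain ⟨C, hC⟩ := exists_enorm_le_of_injective (toLpTwo μ Φ hΦ)
    ((injective_iff_map_eq_zero _).2 fun v hv => hΦ0 v (by
      rw [← enorm_toLpTwo_sq μ Φ hΦ, hv]; simp)) (toLpTwo ν Ψ hΨ)
  refine ⟨C ^ 2, fun v => ?_⟩
  rw [← enorm_toLpTwo_sq μ Φ hΦ, ← enorm_toLpTwo_sq ν Ψ hΨ, ENNReal.coe_pow, ← mul_pow]
  gcongr
  exact hC v

variable {N : ℕ}

lemma isFiniteMeasure_densityMeasure {ρ : Space N → ℝ} (hρ : Integrable ρ) :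
    IsFiniteMeasure (densityMeasure ρ) :=
  isFiniteMeasure_withDensity_ofReal hρ.2

lemma memLp_two_of_mem_testFunctions {u : Space N → ℝ} (hu : u ∈ testFunctions N)
    (μ : Measure (Space N)) [IsFiniteMeasure μ] : MemLp u 2 μ :=
  hu.1.continuous.memLp_of_hasCompactSupport hu.2

lemma lintegral_sq_enorm_lt_top {u : Space N → ℝ} (hu : u ∈ testFunctions N)
    (μ : Measure (Space N)) [IsFiniteMeasure μ] : ∫⁻ x, ‖u x‖ₑ ^ 2 ∂μ < ⊤ := by
  have h := enorm_toLpTwo_sq μ (testFunctions N).subtype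
    (fun v => memLp_two_of_mem_testFunctions v.2 μ) ⟨u, hu⟩
  exact h.symm.trans_lt (ENNReal.pow_lt_top enorm_lt_top)

lemma exists_lintegral_fderiv_le_of_admissibleSubspace {ρ : Space N → ℝ} (hρ : Integrable ρ)
    {k : ℕ} {S : Submodule ℝ (Space N → ℝ)} (hS : AdmissibleSubspace ρ k S) :
    ∃ C : NNReal, ∀ u ∈ S, ∫⁻ x, ‖fderiv ℝ u x‖ₑ ^ 2 ∂gaussianWeight (Space N) ≤
      C * ∫⁻ x, ‖u x‖ₑ ^ 2 ∂densityMeasure ρ := by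
  have := isFiniteMeasure_densityMeasure hρ
  have hfin : FiniteDimensional ℝ S :=
    Module.finite_of_finrank_pos (by rw [hS.finrank_eq]; exact k.succ_pos)
  have hS' := (admissibleSubspace_iff hρ.1.aemeasurable).1 hS
  have hdiff : ∀ u : S, Differentiable ℝ (u : Space N → ℝ) := fun u =>
    (hS.le_testFunctions u.2).1.differentiable (by simp)
  let Ψ : S →ₗ[ℝ] Space N → (Space N →L[ℝ] ℝ) :=
    { toFun := fun u => fderiv ℝ u
      map_add' := fun u v => funext fun x => fderiv_add (hdiff u x) (hdiff v x)
      map_smul' := fun c u => funext fun x => fderiv_const_smul (hdiff u x) c }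
  obtain ⟨C, hC⟩ := exists_lintegral_sq_enorm_le (μ := densityMeasure ρ)
    (ν := gaussianWeight (Space N)) S.subtype
    (fun u => memLp_two_of_mem_testFunctions (hS.le_testFunctions u.2) _)
    (fun u hu => Subtype.ext (hS'.2.2 u u.2 hu)) Ψ fun u => by
      have hu := hS.le_testFunctions u.2
      exact (hu.1.continuous_fderiv (by simp)).memLp_of_hasCompactSupport (hu.2.fderiv ℝ)
  exact ⟨C, fun u hu => hC ⟨u, hu⟩⟩

/-- The functions of a finite-dimensional space of test functions vanish outside a common ball. -/
lemma exists_eq_zero_of_le_norm {S : Submodule ℝ (Space N → ℝ)} (hS : S ≤ testFunctions N)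
    (hfg : S.FG) : ∃ R : ℝ, ∀ u ∈ S, ∀ x, R ≤ ‖x‖ → u x = 0 := by
  obtain ⟨t, rfl⟩ := hfg
  have hone : ∀ u ∈ t, ∃ R : ℝ, ∀ x, R ≤ ‖x‖ → u x = 0 := by
    intro u hu
    obtain ⟨R, hR⟩ := (hS (Submodule.subset_span hu)).2.isCompact.isBounded.subset_ball 0
    refine ⟨R, fun x hx => image_eq_zero_of_notMem_tsupport fun hxu => ?_⟩
    have := hR hxu
    rw [mem_ball_zero_iff] at this
    exact absurd hx (not_le.2 this)
  choose! r hr using hone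
  refine ⟨∑ u ∈ t, |r u|, fun u hu x hx => ?_⟩
  induction hu using Submodule.span_induction with
  | mem v hv =>
    exact hr v hv x ((le_abs_self _).trans
      ((Finset.single_le_sum (f := fun u => |r u|) (fun i _ => abs_nonneg _) hv).trans hx))
  | zero => rfl
  | add v w _ _ hv hw => simp [hv, hw]
  | smul c v _ hv => simp [hv]

/-- A space admissible for `ρ₂` competes for `(ρ₁^ε, ρ₂^ε)` as well; its functions are supported in
`B_{1/ε}` once `ε` is small, so passing to `ρ₂^ε` does not decrease the denominator, and passing to
`ρ₁^ε` adds `O(ε)` to the quotient. -/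
lemma eventually_eigenvalue_reg_le {ρ₁ ρ₂ : Space N → ℝ} (h₁ : Integrable ρ₁)
    (h₁0 : 0 ≤ᵐ[volume] ρ₁) (h₂ : Integrable ρ₂) (h₂0 : 0 ≤ᵐ[volume] ρ₂) {k : ℕ}
    {S : Submodule ℝ (Space N → ℝ)} (hS : AdmissibleSubspace ρ₂ k S) :
    ∃ C : NNReal, ∀ᶠ ε : ℝ in 𝓝[>] 0, eigenvalue k (regNum ρ₁ ε) (regDen ρ₂ ε) ≤
      (⨆ (u : Space N → ℝ) (_ : u ∈ S ∧ u ≠ 0), rayleigh ρ₁ ρ₂ u) + ENNReal.ofReal ε * C := by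
  obtain ⟨C, hC⟩ := exists_lintegral_fderiv_le_of_admissibleSubspace h₂ hS
  have hfin : FiniteDimensional ℝ S :=
    Module.finite_of_finrank_pos (by rw [hS.finrank_eq]; exact k.succ_pos)
  obtain ⟨R, hR⟩ := exists_eq_zero_of_le_norm hS.le_testFunctions (Module.Finite.iff_fg.1 hfin)
  have hS' := (admissibleSubspace_iff h₂.1.aemeasurable).1 hS
  refine ⟨C, ?_⟩
  have hlarge : ∀ᶠ ε : ℝ in 𝓝[>] 0, R ≤ 1 / ε := by
    simpa only [one_div] using tendsto_inv_nhdsGT_zero.eventually_ge_atTop R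
  filter_upwards [hlarge, self_mem_nhdsWithin] with ε hεR hε
  have hε0 : 0 ≤ ε := le_of_lt hε
  have hQ : ∀ u ∈ S, ∫⁻ x, ‖u x‖ₑ ^ 2 ∂densityMeasure ρ₂ ≤
      ∫⁻ x, ‖u x‖ₑ ^ 2 ∂densityMeasure (regDen ρ₂ ε) := by
    intro u hu
    rw [densityMeasure_regDen h₂0 hε0, lintegral_add_measure]
    refine le_add_right (le_of_eq ?_)
    rw [← lintegral_indicator Metric.isOpen_ball.measurableSet]
    refine lintegral_congr fun x => ?_
    by_cases hx : x ∈ Metric.ball (0 : Space N) (1 / ε)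
    · rw [Set.indicator_of_mem hx]
    · rw [Set.indicator_of_notMem hx, hR u hu x]
      · simp
      · rw [mem_ball_zero_iff, not_lt] at hx
        exact hεR.trans hx
  have hSε : AdmissibleSubspace (regDen ρ₂ ε) k S :=
    (admissibleSubspace_iff (aemeasurable_regDen h₂.1.aemeasurable ε)).2 ⟨hS.1, hS.2, fun u hu h0 =>
      hS'.2.2 u hu (le_antisymm ((hQ u hu).trans h0.le) zero_le)⟩
  refine (iInf₂_le S hSε).trans (iSup₂_le fun u hu => ?_)
  have hu1 : ContDiff ℝ 1 u := (hS.le_testFunctions hu.1).1.of_le (by simp)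
  refine le_trans ?_ (add_le_add_left (le_iSup₂ (f := fun u _ => rayleigh ρ₁ ρ₂ u) u hu) _)
  rw [rayleigh_eq_densityMeasure (aemeasurable_regNum h₁.1.aemeasurable ε)
    (aemeasurable_regDen h₂.1.aemeasurable ε) hu1,
    rayleigh_eq_densityMeasure h₁.1.aemeasurable h₂.1.aemeasurable hu1,
    densityMeasure_regNum h₁0 hε0, lintegral_add_measure, lintegral_smul_measure, smul_eq_mul]
  refine (ENNReal.div_le_div_left (hQ u hu.1) _).trans ?_
  rw [ENNReal.add_div, mul_div_assoc]
  gcongr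
  exact ENNReal.div_le_of_le_mul (hC u hu.1)

/-! ### The lower bound -/

/-- Absorbing `κ * T` into the left-hand side of `T ≤ Q + κ * T + η * Q`. -/
lemma le_mul_of_le_add_mul_add_mul {T Q : ℝ≥0∞} (hT : T ≠ ⊤) (hQ : Q ≠ ⊤) {κ η : NNReal}
    (hκ : κ ≤ 1 / 2) (h : T ≤ Q + κ * T + η * Q) :
    T ≤ (1 + 2 * κ + 2 * η : NNReal) * Q := by
  lift T to NNReal using hT
  lift Q to NNReal using hQ
  norm_cast at h ⊢
  rw [← NNReal.coe_le_coe] at h hκ ⊢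
  push_cast at h hκ ⊢
  have h1 : (0 : ℝ) ≤ T := T.2
  have h2 : (0 : ℝ) ≤ Q := Q.2
  have h3 : (0 : ℝ) ≤ κ := κ.2
  have h4 : (0 : ℝ) ≤ η := η.2
  have key : (1 - (κ : ℝ)) * T ≤ (1 - κ) * ((1 + 2 * κ + 2 * η) * Q) := by
    have h5 : 0 ≤ (1 - 2 * (κ : ℝ)) * ((κ + η) * Q) :=
      mul_nonneg (by linarith) (by positivity)
    linarith
  exact le_of_mul_le_mul_left key (by linarith)

/-- If the regularized Rayleigh quotient of `u` is at most `a`, then the Gaussian part `ε² ∫ u² γ` of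
the regularized denominator is a small multiple of the denominator for `ρ₂`: the energy
`ε ∫ |∇u|² γ` is at most `a` times the regularized denominator, and it controls `∫ u² γ` up to
`∫ ρ₂ u²`. -/
lemma lintegral_regDen_le {ρ₁ ρ₂ : Space N → ℝ} (h₁0 : 0 ≤ᵐ[volume] ρ₁)
    (h₂ : Integrable ρ₂) (h₂0 : 0 ≤ᵐ[volume] ρ₂) {A B : NNReal}
    (hAB : ∀ u : Space N → ℝ, ContDiff ℝ 1 u → ∫⁻ x, ‖u x‖ₑ ^ 2 ∂gaussianWeight (Space N) ≤
        A * (∫⁻ x, ‖fderiv ℝ u x‖ₑ ^ 2 ∂gaussianWeight (Space N)) +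
          B * ∫⁻ x, ‖u x‖ₑ ^ 2 ∂densityMeasure ρ₂)
    {u : Space N → ℝ} (hu : u ∈ testFunctions N) {a : NNReal} {ε : ℝ}
    (hε : 0 < ε) (hεA : ε.toNNReal * (A * a) ≤ 1 / 2)
    (ha : ∫⁻ x, ‖fderiv ℝ u x‖ₑ ^ 2 ∂densityMeasure (regNum ρ₁ ε) ≤
      a * ∫⁻ x, ‖u x‖ₑ ^ 2 ∂densityMeasure (regDen ρ₂ ε)) :
    ∫⁻ x, ‖u x‖ₑ ^ 2 ∂densityMeasure (regDen ρ₂ ε) ≤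
      (1 + 2 * (ε.toNNReal * (A * a)) + 2 * (ε.toNNReal ^ 2 * B) : NNReal) *
        ∫⁻ x, ‖u x‖ₑ ^ 2 ∂densityMeasure ρ₂ := by
  have := isFiniteMeasure_densityMeasure h₂
  have hu1 : ContDiff ℝ 1 u := hu.1.of_le (by simp)
  set e : NNReal := ε.toNNReal with he
  have hee : ENNReal.ofReal ε = e := rfl
  set T := ∫⁻ x, ‖u x‖ₑ ^ 2 ∂densityMeasure (regDen ρ₂ ε) with hT
  set Q := ∫⁻ x, ‖u x‖ₑ ^ 2 ∂densityMeasure ρ₂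
  set P := ∫⁻ x, ‖u x‖ₑ ^ 2 ∂gaussianWeight (Space N)
  set D := ∫⁻ x, ‖fderiv ℝ u x‖ₑ ^ 2 ∂gaussianWeight (Space N)
  have hTQ : T ≤ Q + (e : ℝ≥0∞) ^ 2 * P := by
    rw [hT, densityMeasure_regDen h₂0 hε.le, lintegral_add_measure, lintegral_smul_measure,
      smul_eq_mul, hee]
    gcongr
    exact lintegral_mono' Measure.restrict_le_self le_rfl
  have hQtop : Q ≠ ⊤ := (lintegral_sq_enorm_lt_top hu _).ne
  have hPtop : P ≠ ⊤ := (lintegral_sq_enorm_lt_top hu _).ne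
  have hD : (e : ℝ≥0∞) * D ≤ a * T := by
    refine le_trans ?_ ha
    rw [densityMeasure_regNum h₁0 hε.le, lintegral_add_measure, lintegral_smul_measure,
      smul_eq_mul, hee]
    exact le_add_self
  refine le_mul_of_le_add_mul_add_mul (ne_top_of_le_ne_top (by finiteness) hTQ) hQtop hεA ?_
  calc T ≤ Q + (e : ℝ≥0∞) ^ 2 * P := hTQ
    _ ≤ Q + (e : ℝ≥0∞) ^ 2 * (A * D + B * Q) := by gcongr; exact hAB u hu1
    _ = Q + e * A * (e * D) + (e : ℝ≥0∞) ^ 2 * B * Q := by ring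
    _ ≤ Q + e * A * (a * T) + (e : ℝ≥0∞) ^ 2 * B * Q := by gcongr
    _ = _ := by push_cast; ring

/-- A space on which the regularized quotients stay below `a` is admissible for `ρ₂`, and its
quotients for `(ρ₁, ρ₂)` exceed `a` by at most a factor tending to `1`. -/
lemma eigenvalue_le_of_eigenvalue_reg_lt {ρ₁ ρ₂ : Space N → ℝ} (h₁ : Integrable ρ₁)
    (h₁0 : 0 ≤ᵐ[volume] ρ₁) (h₂ : Integrable ρ₂) (h₂0 : 0 ≤ᵐ[volume] ρ₂) {A B : NNReal}
    (hAB : ∀ u : Space N → ℝ, ContDiff ℝ 1 u → ∫⁻ x, ‖u x‖ₑ ^ 2 ∂gaussianWeight (Space N) ≤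
        A * (∫⁻ x, ‖fderiv ℝ u x‖ₑ ^ 2 ∂gaussianWeight (Space N)) +
          B * ∫⁻ x, ‖u x‖ₑ ^ 2 ∂densityMeasure ρ₂)
    {k : ℕ} {a : NNReal} {ε : ℝ} (hε : 0 < ε) (hεA : ε.toNNReal * (A * a) ≤ 1 / 2)
    (hlt : eigenvalue k (regNum ρ₁ ε) (regDen ρ₂ ε) < a) :
    eigenvalue k ρ₁ ρ₂ ≤
      ((1 + 2 * (ε.toNNReal * (A * a)) + 2 * (ε.toNNReal ^ 2 * B)) * a : NNReal) := by
  have := isFiniteMeasure_densityMeasure h₂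
  obtain ⟨S, hSε, hSa⟩ : ∃ S, ∃ _ : AdmissibleSubspace (regDen ρ₂ ε) k S,
      (⨆ (u : Space N → ℝ) (_ : u ∈ S ∧ u ≠ 0), rayleigh (regNum ρ₁ ε) (regDen ρ₂ ε) u) < a := by
    simpa only [eigenvalue, iInf_lt_iff] using hlt
  have hSε' := (admissibleSubspace_iff (aemeasurable_regDen h₂.1.aemeasurable ε)).1 hSε
  set c : NNReal := 1 + 2 * (ε.toNNReal * (A * a)) + 2 * (ε.toNNReal ^ 2 * B) with hc
  have hreg : ∀ u ∈ S, u ≠ 0 →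
      ∫⁻ x, ‖fderiv ℝ u x‖ₑ ^ 2 ∂densityMeasure (regNum ρ₁ ε) ≤
        a * ∫⁻ x, ‖u x‖ₑ ^ 2 ∂densityMeasure (regDen ρ₂ ε) := by
    intro u hu hu0
    have hr : rayleigh (regNum ρ₁ ε) (regDen ρ₂ ε) u ≤ a :=
      (le_iSup₂ (f := fun u _ => rayleigh (regNum ρ₁ ε) (regDen ρ₂ ε) u) u ⟨hu, hu0⟩).trans hSa.le
    rw [rayleigh_eq_densityMeasure (aemeasurable_regNum h₁.1.aemeasurable ε)
      (aemeasurable_regDen h₂.1.aemeasurable ε)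
      ((hSε.le_testFunctions hu).1.of_le (by simp))] at hr
    have hfin : ∫⁻ x, ‖u x‖ₑ ^ 2 ∂densityMeasure (regDen ρ₂ ε) ≠ ⊤ := by
      rw [densityMeasure_regDen h₂0 hε.le, lintegral_add_measure, lintegral_smul_measure,
        smul_eq_mul]
      have h3 := (lintegral_sq_enorm_lt_top (hSε.le_testFunctions hu)
        ((densityMeasure ρ₂).restrict (Metric.ball 0 (1 / ε)))).ne
      have h4 := (lintegral_sq_enorm_lt_top (hSε.le_testFunctions hu)
        (gaussianWeight (Space N))).ne
      finiteness
    exact (ENNReal.div_le_iff (fun h0 => hu0 (hSε'.2.2 u hu h0)) hfin).1 hr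
  have hden : ∀ u ∈ S, u ≠ 0 → ∫⁻ x, ‖u x‖ₑ ^ 2 ∂densityMeasure (regDen ρ₂ ε) ≤
      c * ∫⁻ x, ‖u x‖ₑ ^ 2 ∂densityMeasure ρ₂ := fun u hu hu0 =>
    lintegral_regDen_le h₁0 h₂ h₂0 hAB (hSε.le_testFunctions hu) hε hεA (hreg u hu hu0)
  have hS : AdmissibleSubspace ρ₂ k S := by
    refine (admissibleSubspace_iff h₂.1.aemeasurable).2 ⟨hSε.1, hSε.2, fun u hu h0 => ?_⟩
    by_contra hu0
    refine hu0 (hSε'.2.2 u hu ?_)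
    simpa [h0] using hden u hu hu0
  refine (iInf₂_le S hS).trans (iSup₂_le fun u hu => ?_)
  rw [rayleigh_eq_densityMeasure h₁.1.aemeasurable h₂.1.aemeasurable
    ((hS.le_testFunctions hu.1).1.of_le (by simp))]
  refine ENNReal.div_le_of_le_mul ?_
  calc ∫⁻ x, ‖fderiv ℝ u x‖ₑ ^ 2 ∂densityMeasure ρ₁
      ≤ ∫⁻ x, ‖fderiv ℝ u x‖ₑ ^ 2 ∂densityMeasure (regNum ρ₁ ε) := by
        rw [densityMeasure_regNum h₁0 hε.le, lintegral_add_measure]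
        exact le_self_add
    _ ≤ a * ∫⁻ x, ‖u x‖ₑ ^ 2 ∂densityMeasure (regDen ρ₂ ε) := hreg u hu.1 hu.2
    _ ≤ a * (c * ∫⁻ x, ‖u x‖ₑ ^ 2 ∂densityMeasure ρ₂) := by gcongr; exact hden u hu.1 hu.2
    _ = _ := by push_cast; ring

end DensityEigenvalue

/-! ### Convergence of the eigenvalues -/

theorem mainTheorem8 (N : ℕ) (hN : 1 ≤ N)
    (ρ₁ ρ₂ : DensityEigenvalue.Space N → ℝ)
    (hρ₁_nonneg : 0 ≤ᵐ[volume] ρ₁) (hρ₂_nonneg : 0 ≤ᵐ[volume] ρ₂)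
    (hρ₁_L1 : MemLp ρ₁ 1 volume) (hρ₁_Linfty : MemLp ρ₁ ∞ volume)
    (hρ₂_L1 : MemLp ρ₂ 1 volume) (hρ₂_Linfty : MemLp ρ₂ ∞ volume)
    (hρ₂_ne : ¬ ρ₂ =ᵐ[volume] 0) (k : ℕ) :
    Tendsto
      (fun ε : ℝ => DensityEigenvalue.eigenvalue k
        (DensityEigenvalue.regNum ρ₁ ε) (DensityEigenvalue.regDen ρ₂ ε))
      (𝓝[>] 0) (𝓝 (DensityEigenvalue.eigenvalue k ρ₁ ρ₂)) := by
  have h₁ := memLp_one_iff_integrable.1 hρ₁_L1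
  have h₂ := memLp_one_iff_integrable.1 hρ₂_L1
  refine tendsto_order.2 ⟨fun a ha => ?_, fun b hb => ?_⟩
  · obtain ⟨A, B, hAB⟩ := DensityEigenvalue.exists_lintegral_gaussianWeight_sq_enorm_le
      h₂.1.aemeasurable fun h => hρ₂_ne (h.antisymm hρ₂_nonneg)
    -- A finite level strictly between `a` and the eigenvalue leaves room for the factor `1 + O(ε)`,
    -- also when the eigenvalue is `∞`.
    obtain ⟨a', haa', ha'⟩ := ENNReal.lt_iff_exists_nnreal_btwn.1 ha
    have hsmall : ∀ᶠ ε : ℝ in 𝓝[>] 0, ε.toNNReal * (A * a') < 1 / 2 := by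
      have hc : Continuous fun ε : ℝ => ε.toNNReal * (A * a') := by fun_prop
      exact (hc.tendsto 0).mono_left nhdsWithin_le_nhds |>.eventually_lt_const (by simp)
    have hfactor : ∀ᶠ ε : ℝ in 𝓝[>] 0,
        (((1 + 2 * (ε.toNNReal * (A * a')) + 2 * (ε.toNNReal ^ 2 * B)) * a' : NNReal) : ℝ≥0∞) <
          DensityEigenvalue.eigenvalue k ρ₁ ρ₂ := by
      have hc : Continuous fun ε : ℝ =>
          (((1 + 2 * (ε.toNNReal * (A * a')) + 2 * (ε.toNNReal ^ 2 * B)) * a' : NNReal) : ℝ≥0∞) :=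
        ENNReal.continuous_coe.comp (by fun_prop)
      exact (hc.tendsto 0).mono_left nhdsWithin_le_nhds |>.eventually_lt_const (by simpa using ha')
    filter_upwards [hsmall, hfactor, self_mem_nhdsWithin] with ε hεA hε hε0
    by_contra! hle
    exact absurd (DensityEigenvalue.eigenvalue_le_of_eigenvalue_reg_lt h₁ hρ₁_nonneg h₂ hρ₂_nonneg
      hAB hε0 hεA.le (hle.trans_lt haa')) (not_le.2 hε)
  · obtain ⟨S, hS, hSb⟩ : ∃ S, ∃ _ : DensityEigenvalue.AdmissibleSubspace ρ₂ k S,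
        (⨆ (u : DensityEigenvalue.Space N → ℝ) (_ : u ∈ S ∧ u ≠ 0),
          DensityEigenvalue.rayleigh ρ₁ ρ₂ u) < b := by
      simpa only [DensityEigenvalue.eigenvalue, iInf_lt_iff] using hb
    obtain ⟨C, hC⟩ := DensityEigenvalue.eventually_eigenvalue_reg_le h₁ hρ₁_nonneg h₂ hρ₂_nonneg hS
    have hsmall : ∀ᶠ ε : ℝ in 𝓝[>] 0,
        (⨆ (u : DensityEigenvalue.Space N → ℝ) (_ : u ∈ S ∧ u ≠ 0),
          DensityEigenvalue.rayleigh ρ₁ ρ₂ u) + ENNReal.ofReal ε * C < b := by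
      have hc : Continuous fun ε : ℝ =>
          (⨆ (u : DensityEigenvalue.Space N → ℝ) (_ : u ∈ S ∧ u ≠ 0),
            DensityEigenvalue.rayleigh ρ₁ ρ₂ u) + ENNReal.ofReal ε * C :=
        continuous_const.add ((ENNReal.continuous_mul_const ENNReal.coe_ne_top).comp
          ENNReal.continuous_ofReal)
      exact (hc.tendsto 0).mono_left nhdsWithin_le_nhds |>.eventually_lt_const (by simpa using hSb)
    filter_upwards [hC, hsmall] with ε h h' using h.trans_lt h'
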